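/- Let $L\subseteq\mathbb Z^n$ be a subgroup and let $M\subseteq\mathbb Z^n$ be a nonzero finitely generated submonoid with $M=\mathrm{cone}(M)\cap L$, where $\mathrm{cone}(M)\subseteq\mathbb R^n$ is the cone generated by $M$. Let $\deg: M\to\mathbb Z$ be a positive grading, i.e. a monoid homomorphism with $\deg x>0$ for all $x\in M$, $x\ne 0$. Let $\operatorname{rank}M$ be the rank of the subgroup $\mathrm{gp}(M)$ generated by $M$. Let $\Sigma$ be a triangulation of $\mathrm{cone}(M)$ into simplicial cones of full dimension $\operatorname{rank} M$: a finite set of pairwise distinct cones with union $\mathrm{cone}(M)$, any two of which intersect in a common face of both, each equipped with a chosen generating set consisting of $\operatorname{rank}M$ linearly independent vectors of $M$. Let $\ell$ be the least common multiple of the degrees of all these chosen generators. Let $f\in\mathbb Q[X_1,\dots,X_n]$ be a polynomial of total degree $\deg f$ (with $\deg 0:=0$). Then for every $k\ge 0$ there are only finitely many $x\in M$ with $\deg x=k$, and the generalized Ehrhart series satisfies $$E_{M,f}(t)=\sum_{x\in M}f(x)\,t^{\deg x}=\sum_{k=0}^\infty q(k)\,t^k ,$$ where $q$ is a rational quasipolynomial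 of period $\pi$ dividing $\ell$ and of degree $\le\deg f+\operatorname{rank}M-1$; that is, there are an integer $\pi\ge1$ with $\pi\mid\ell$ and polynomials $q^{(0)},\dots,q^{(\pi-1)}\in\mathbb Q[X]$ of degree $\le\deg f+\operatorname{rank}M-1$ such that $q(k)=q^{(j)}(k)$ whenever $k\ge 0$, $0\le j<\pi$ and $k\equiv j\pmod\pi$. -/

import Mathlib

noncomputable section

/-- The inclusion `ℤⁿ → ℝⁿ`. -/
def intVec {n : ℕ} (x : Fin n → ℤ) : Fin n → ℝ := fun i => (x i : ℝ)

/-- The cone in `ℝⁿ` generated by a set of integer vectors: all linear combinations of elements of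
the set with nonnegative real coefficients. -/
def realCone {n : ℕ} (S : Set (Fin n → ℤ)) : PointedCone ℝ (Fin n → ℝ) :=
  PointedCone.hull ℝ (intVec '' S)

/-- The rank of a submonoid `M` of `ℤⁿ`, that is, of the subgroup `gp(M)` generated by `M`. -/
def monoidRank {n : ℕ} (M : AddSubmonoid (Fin n → ℤ)) : ℕ :=
  Module.finrank ℤ (Submodule.span ℤ (M : Set (Fin n → ℤ)))

/-- A `ℤ`-grading of `M` is positive if all nonzero elements have positive degree. -/
def IsPositiveGrading {n : ℕ} {M : AddSubmonoid (Fin n → ℤ)} (deg : M →+ ℤ) : Prop :=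
  ∀ x : M, x ≠ 0 → 0 < deg x

/-- The cone in `ℝⁿ` generated by a finite set of elements of `M`. -/
def subcone {n : ℕ} {M : AddSubmonoid (Fin n → ℤ)} (σ : Finset M) :
    PointedCone ℝ (Fin n → ℝ) :=
  realCone ((fun v : M => (v : Fin n → ℤ)) '' (σ : Set M))

/-- A triangulation of `cone(M)` into simplicial cones of full dimension generated by elements
of `M`. Each cone is given by its chosen set `σ` of linearly independent generators in `M`. -/
structure IsConeTriangulation {n : ℕ} (M : AddSubmonoid (Fin n → ℤ))
    (T : Finset (Finset M)) : Prop where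
  linearIndependent : ∀ σ ∈ T, LinearIndependent ℝ (fun v : σ => intVec ((v : M) : Fin n → ℤ))
  card_eq : ∀ σ ∈ T, σ.card = monoidRank M
  /-- distinct members of `T` are generating sets of distinct cones -/
  injOn : Set.InjOn subcone (T : Set (Finset M))
  cover : (realCone (M : Set (Fin n → ℤ)) : Set (Fin n → ℝ)) =
    ⋃ σ ∈ T, (subcone σ : Set (Fin n → ℝ))
  /-- two cones meet in a common face (stated for one of the two, by symmetry) -/
  face : ∀ σ ∈ T, ∀ τ ∈ T, (subcone σ ⊓ subcone τ).IsFaceOf (subcone σ)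

/-- The least common multiple of the degrees of the generators that appear in `T`. -/
def degreeLcm {n : ℕ} {M : AddSubmonoid (Fin n → ℤ)} (deg : M →+ ℤ)
    (T : Finset (Finset M)) : ℕ :=
  T.lcm fun σ => σ.lcm fun v => (deg v).natAbs

/-- The generalized Ehrhart series `∑_{x ∈ M} f(x) t ^ deg x`: the coefficient of `t ^ k` is the
sum of `f(x)` over all `x ∈ M` of degree `k`. -/
def ehrhartSeries {n : ℕ} {M : AddSubmonoid (Fin n → ℤ)} (deg : M →+ ℤ)
    (f : MvPolynomial (Fin n) ℚ) : PowerSeries ℚ :=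
  PowerSeries.mk fun k => ∑ᶠ x ∈ {x : M | deg x = (k : ℤ)},
    MvPolynomial.eval (fun i => (((x : Fin n → ℤ) i : ℤ) : ℚ)) f

/-- `q` is a rational quasipolynomial of period `π` and of degree at most `D`: there are
polynomials `p j`, one for each residue class `j` modulo `π`, with rational coefficients and of
degree at most `D`, such that `q k = p j k` whenever `k ≡ j` modulo `π`. -/
def IsRatQuasipolynomial (q : ℕ → ℚ) (π D : ℕ) : Prop :=
  0 < π ∧ ∃ p : ℕ → Polynomial ℚ,
    (∀ j < π, (p j).natDegree ≤ D) ∧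
    ∀ j < π, ∀ k : ℕ, k ≡ j [MOD π] → q k = (p j).eval (k : ℚ)

end

/-!
Why the series is a quasipolynomial in every degree `k ≥ 0`, and not only for large `k`.

Choose `w ∈ M` on none of the hyperplanes spanned by the facets of the cones of the triangulation
(`exists_forall_apply_ne_zero`). For `x ∈ M` the points `N • x + w`, with `N` large, lie in the
interior of exactly one cone `σ`, and `x` is assigned to that cone. The points assigned to `σ` are those
of the half-open cone obtained by removing the facets that separate `σ` from `w`, so `M` is the
disjoint union of its intersections with these half-open cones
(`IsConeTriangulation.exists_isHalfOpenMem`, `IsConeTriangulation.eq_of_isHalfOpenMem`).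

Replace each generator of `σ` by its multiple of degree `ℓ`, the least common multiple. Because
`M = cone(M) ∩ L`, each point of the half-open cone is uniquely `y + ∑ i, m i • v i`, where the `v i` are
these multiples, `m i ∈ ℕ`, and `y` lies in the finite set of points of `M` in a half-open parallelotope.
Its degree is `deg y + ℓ * ∑ i, m i`, and `f` is there a polynomial in `m` of degree at most `deg f`.
So each `y` contributes `t ^ deg y * G(t ^ ℓ)`, where `G` is the series of the sums of a polynomial over
`∑ i, m i = s`; it is a polynomial of degree at most `deg f` over `(1 - t) ^ (deg f + r)` with
`r = rank M` (`exists_simplexSeries_mul_one_sub_pow`).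

The positive grading forces `w` to have a positive coordinate with respect to `σ`. So not all facets
are removed, and `deg y < r * ℓ` (`IsSimplicialCoords.degree_lt_of_mem_halfOpenBox`). This makes the
rational function have negative degree, and the polynomial formula for its coefficients then holds
from the constant term on (`exists_eval_eq_coeff_of_mul_one_sub_pow`).
-/

open Finset

/-! ### Generating series of polynomial functions on `ℕ^ι` -/

/-- The series `∑ kᵃ tᵏ` is a polynomial of degree at most `a` divided by `(1 - t) ^ (a + 1)`. The
induction on `a` applies the operator `t · d/dt`. -/
theorem exists_mk_pow_mul_one_sub_pow (a : ℕ) :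
    ∃ N : Polynomial ℚ, N.natDegree ≤ a ∧
      PowerSeries.mk (fun k : ℕ => (k : ℚ) ^ a) * (1 - PowerSeries.X) ^ (a + 1) = (N : PowerSeries ℚ) := by
  induction a with
  | zero =>
    refine ⟨1, by simp, ?_⟩
    have := PowerSeries.mk_one_mul_one_sub_eq_one ℚ
    simpa [Pi.one_def] using this
  | succ a ih =>
    obtain ⟨N, hN, h⟩ := ih
    set F := PowerSeries.mk (fun k : ℕ => (k : ℚ) ^ a)
    have hF : PowerSeries.mk (fun k : ℕ => (k : ℚ) ^ (a + 1)) =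
        PowerSeries.X * PowerSeries.derivative ℚ F := by
      ext k
      cases k with
      | zero => simp
      | succ k =>
        rw [mul_comm, PowerSeries.coeff_succ_mul_X, PowerSeries.coeff_derivative]
        simp [F, pow_succ]
    have hd := congrArg (PowerSeries.derivative ℚ) h
    simp only [Derivation.leibniz, Derivation.leibniz_pow, PowerSeries.derivative_coe, smul_eq_mul,
      map_sub, Derivation.map_one_eq_zero, PowerSeries.derivative_X, Nat.add_sub_cancel,
      nsmul_eq_mul] at hd
    refine ⟨Polynomial.X * (1 - Polynomial.X) * Polynomial.derivative N +
      ((a + 1 : ℕ) : Polynomial ℚ) * Polynomial.X * N, ?_, ?_⟩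
    · rcases Nat.eq_zero_or_pos a with rfl | ha
      · obtain ⟨c, rfl⟩ : ∃ c, N = Polynomial.C c :=
          ⟨_, Polynomial.eq_C_of_natDegree_le_zero hN⟩
        simp only [Polynomial.derivative_C, mul_zero, zero_add]
        compute_degree
      · have := (Polynomial.natDegree_derivative_le N)
        have h1 : (Polynomial.X * (1 - Polynomial.X) : Polynomial ℚ).natDegree ≤ 2 := by
          compute_degree
        have h2 : (((a + 1 : ℕ) : Polynomial ℚ) * Polynomial.X).natDegree ≤ 1 := by
          compute_degree
        refine Polynomial.natDegree_add_le_of_degree_le ?_ ?_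
        · exact Polynomial.natDegree_mul_le.trans (by omega)
        · exact Polynomial.natDegree_mul_le.trans (by omega)
    · have ha : ((a : Polynomial ℚ) : PowerSeries ℚ) = a :=
        map_natCast Polynomial.coeToPowerSeries.ringHom a
      rw [hF]
      push_cast
      rw [← h, ← hd, ha]
      push_cast
      ring

/-- If the numerator over `(1 - t) ^ (d + 1)` has degree at most `d`, so that the rational function has
negative degree, then the coefficients are the values of one polynomial from the very first on. -/
theorem exists_eval_eq_coeff_of_mul_one_sub_pow {F : PowerSeries ℚ} {N : Polynomial ℚ} {d : ℕ}
    (hN : N.natDegree ≤ d) (h : F * (1 - PowerSeries.X) ^ (d + 1) = (N : PowerSeries ℚ)) :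
    ∃ P : Polynomial ℚ, P.natDegree ≤ d ∧ ∀ s : ℕ, PowerSeries.coeff s F = P.eval (s : ℚ) := by
  have hF : F = N * PowerSeries.mk fun n => ((d + n).choose d : ℚ) := by
    rw [← h, mul_assoc, mul_comm (_ ^ _), PowerSeries.mk_add_choose_mul_one_sub_pow_eq_one, mul_one]
  refine ⟨∑ j ∈ range (d + 1), Polynomial.C (N.coeff j / (d.factorial : ℚ)) *
    (descPochhammer ℚ d).comp (Polynomial.X + Polynomial.C ((d : ℚ) - j)), ?_, fun s => ?_⟩
  · refine Polynomial.natDegree_sum_le_of_forall_le _ _ fun j _ => ?_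
    refine (Polynomial.natDegree_C_mul_le _ _).trans ?_
    refine Polynomial.natDegree_comp_le.trans ?_
    rw [descPochhammer_natDegree, Polynomial.natDegree_X_add_C, mul_one]
  · have hN' : (N : PowerSeries ℚ) =
        ∑ j ∈ range (d + 1), PowerSeries.C (N.coeff j) * PowerSeries.X ^ j := by
      conv_lhs => rw [N.as_sum_range_C_mul_X_pow' (Nat.lt_succ_of_le hN)]
      rw [← Polynomial.coeToPowerSeries.ringHom_apply, map_sum]
      simp [Polynomial.coeToPowerSeries.ringHom_apply]
    rw [hF, hN', sum_mul, map_sum, Polynomial.eval_finsetSum]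
    refine sum_congr rfl fun j hj => ?_
    rw [mul_assoc, PowerSeries.coeff_C_mul, mul_comm (PowerSeries.X ^ j),
      PowerSeries.coeff_mul_X_pow', PowerSeries.coeff_mk]
    have hj' : j ≤ d := Nat.lt_succ_iff.mp (mem_range.mp hj)
    -- `s + d - j` is a natural number because `j ≤ d`; for `s < j` it is a root of the
    -- descending Pochhammer polynomial.
    have key : (descPochhammer ℚ d).eval ((s : ℚ) + (d - j)) =
        d.factorial * ((s + d - j).choose d : ℚ) := by
      have : (s : ℚ) + (d - j) = ((s + d - j : ℕ) : ℚ) := by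
        rw [Nat.cast_sub (by omega)]; push_cast; ring
      rw [this, descPochhammer_eval_eq_descFactorial, Nat.descFactorial_eq_factorial_mul_choose]
      push_cast; rfl
    have hd : (d.factorial : ℚ) ≠ 0 := by positivity
    simp only [Polynomial.eval_mul, Polynomial.eval_C, Polynomial.eval_comp, Polynomial.eval_add,
      Polynomial.eval_X, key]
    split_ifs with hjs
    · rw [show d + (s - j) = s + d - j by omega]
      field_simp
    · rw [Nat.choose_eq_zero_of_lt (by omega : s + d - j < d)]
      simp

/-- A substitution of affine-linear polynomials does not raise the total degree. -/
theorem totalDegree_aeval_le {σ ι : Type*} (f : MvPolynomial σ ℚ) (l : σ → MvPolynomial ι ℚ)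
    (hl : ∀ i, (l i).totalDegree ≤ 1) :
    (MvPolynomial.aeval l f).totalDegree ≤ f.totalDegree := by
  rw [MvPolynomial.aeval_def, MvPolynomial.eval₂_eq]
  refine MvPolynomial.totalDegree_finsetSum_le fun a ha => ?_
  refine (MvPolynomial.totalDegree_mul _ _).trans ?_
  rw [MvPolynomial.algebraMap_eq, MvPolynomial.totalDegree_C, zero_add]
  refine (MvPolynomial.totalDegree_finsetProd _ _).trans
    (le_trans (sum_le_sum fun i _ => ?_) (MvPolynomial.le_totalDegree ha))
  refine (MvPolynomial.totalDegree_pow _ _).trans ?_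
  simpa using Nat.mul_le_mul_left (a i) (hl i)

section SimplexSeries

variable {ι : Type*} [Fintype ι] [DecidableEq ι]

/-- The generating series whose `s`-th coefficient is the sum of `g(m)` over all `m ∈ ℕ^ι` with
`∑ i, m i = s`. -/
noncomputable def simplexSeries (g : MvPolynomial ι ℚ) : PowerSeries ℚ :=
  PowerSeries.mk fun s => ∑ m ∈ finsuppAntidiag univ s, g.eval fun i => ((m i : ℕ) : ℚ)

theorem simplexSeries_sum {κ : Type*} (S : Finset κ) (g : κ → MvPolynomial ι ℚ) :
    simplexSeries (∑ k ∈ S, g k) = ∑ k ∈ S, simplexSeries (g k) := by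
  ext s
  simp only [simplexSeries, PowerSeries.coeff_mk, map_sum]
  exact sum_comm

theorem simplexSeries_monomial (a : ι →₀ ℕ) (c : ℚ) :
    simplexSeries (MvPolynomial.monomial a c) =
      PowerSeries.C c * ∏ i, PowerSeries.mk fun k : ℕ => (k : ℚ) ^ a i := by
  ext s
  rw [PowerSeries.coeff_C_mul, PowerSeries.coeff_prod, simplexSeries, PowerSeries.coeff_mk, mul_sum]
  refine sum_congr rfl fun m _ => ?_
  simp [MvPolynomial.eval_monomial, Finsupp.prod_fintype]

/-- For a monomial `g` the series is a product of the one-variable series `∑ kᵃ tᵏ`; in general the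
summands are brought to a common denominator. -/
theorem exists_simplexSeries_mul_one_sub_pow (g : MvPolynomial ι ℚ) {D : ℕ}
    (hD : g.totalDegree ≤ D) :
    ∃ N : Polynomial ℚ, N.natDegree ≤ D ∧
      simplexSeries g * (1 - PowerSeries.X) ^ (D + Fintype.card ι) = (N : PowerSeries ℚ) := by
  have hmon : ∀ a ∈ g.support, ∃ N : Polynomial ℚ, N.natDegree ≤ D ∧
      simplexSeries (MvPolynomial.monomial a (g.coeff a)) *
        (1 - PowerSeries.X) ^ (D + Fintype.card ι) = (N : PowerSeries ℚ) := by
    intro a ha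
    have had : ∑ i, a i ≤ D := by
      have := (MvPolynomial.le_totalDegree ha).trans hD
      rwa [Finsupp.sum_fintype _ _ (by simp)] at this
    choose N hN h using fun i => exists_mk_pow_mul_one_sub_pow (a i)
    refine ⟨Polynomial.C (g.coeff a) * ((∏ i, N i) * (1 - Polynomial.X) ^ (D - ∑ i, a i)), ?_, ?_⟩
    · refine (Polynomial.natDegree_C_mul_le _ _).trans (Polynomial.natDegree_mul_le.trans ?_)
      have h1 : (∏ i, N i).natDegree ≤ ∑ i, a i :=
        (Polynomial.natDegree_prod_le _ _).trans (sum_le_sum fun i _ => hN i)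
      have h2 : ((1 - Polynomial.X : Polynomial ℚ) ^ (D - ∑ i, a i)).natDegree ≤ D - ∑ i, a i := by
        have : (1 - Polynomial.X : Polynomial ℚ).natDegree ≤ 1 := by compute_degree
        exact (Polynomial.natDegree_pow_le).trans (by nlinarith)
      omega
    · have hexp : D + Fintype.card ι = ∑ i, (a i + 1) + (D - ∑ i, a i) := by
        rw [sum_add_distrib]; simp; omega
      rw [simplexSeries_monomial, hexp, pow_add, ← prod_pow_eq_pow_sum]
      have : ((∏ i, N i : Polynomial ℚ) : PowerSeries ℚ) = ∏ i, (N i : PowerSeries ℚ) := by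
        simp only [← Polynomial.coeToPowerSeries.ringHom_apply, map_prod]
      push_cast
      rw [this, ← prod_congr rfl fun i _ => h i, prod_mul_distrib]
      ring
  choose! N hN h using hmon
  refine ⟨∑ a ∈ g.support, N a, Polynomial.natDegree_sum_le_of_forall_le _ _ hN, ?_⟩
  conv_lhs => rw [g.as_sum]
  rw [simplexSeries_sum, sum_mul, sum_congr rfl h]
  simp only [← Polynomial.coeToPowerSeries.ringHom_apply, map_sum]

/-- The shift by `u < card ι` keeps the degree of the numerator below that of the denominator, and
hence the polynomial formula valid for all coefficients. -/
theorem exists_eval_eq_coeff_X_pow_mul_simplexSeries (g : MvPolynomial ι ℚ) {D u : ℕ}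
    (hD : g.totalDegree ≤ D) (hu : u < Fintype.card ι) :
    ∃ P : Polynomial ℚ, P.natDegree ≤ D + Fintype.card ι - 1 ∧
      ∀ s : ℕ, PowerSeries.coeff s (PowerSeries.X ^ u * simplexSeries g) = P.eval (s : ℚ) := by
  obtain ⟨N, hN, h⟩ := exists_simplexSeries_mul_one_sub_pow g hD
  refine exists_eval_eq_coeff_of_mul_one_sub_pow (N := Polynomial.X ^ u * N) ?_ ?_
  · refine Polynomial.natDegree_mul_le.trans ?_
    rw [Polynomial.natDegree_X_pow]
    omega
  · rw [Nat.sub_add_cancel (by omega), mul_assoc, h]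
    push_cast
    rfl

end SimplexSeries

/-! ### Quasipolynomials -/

theorem IsRatQuasipolynomial.sum {κ : Type*} {s : Finset κ} {q : κ → ℕ → ℚ} {π D : ℕ} (hπ : 0 < π)
    (h : ∀ i ∈ s, IsRatQuasipolynomial (q i) π D) :
    IsRatQuasipolynomial (fun k => ∑ i ∈ s, q i k) π D := by
  choose! p hp hq using fun i hi => (h i hi).2
  refine ⟨hπ, fun j => ∑ i ∈ s, p i j, fun j hj => ?_, fun j hj k hk => ?_⟩
  · exact Polynomial.natDegree_sum_le_of_forall_le _ _ fun i hi => hp i hi j hj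
  · rw [Polynomial.eval_finsetSum]
    exact sum_congr rfl fun i hi => hq i hi j hj k hk

/-- The sums of `g(m)` over all `m` with `e + ℓ * ∑ i, m i = k` form a quasipolynomial in `k` that lives
on the residue class of `e`. With `u = e / ℓ` they are the coefficients of `t ^ u` times the
generating series of `g`, and the bound on `e` says that `u < card ι`. -/
theorem exists_finset_isRatQuasipolynomial_sum {ι : Type*} [Fintype ι] (g : MvPolynomial ι ℚ)
    {D ℓ e : ℕ} (hD : g.totalDegree ≤ D) (hℓ : 0 < ℓ) (he : e < Fintype.card ι * ℓ) :
    ∃ I : ℕ → Finset (ι →₀ ℕ), (∀ k m, m ∈ I k ↔ e + ℓ * ∑ i, m i = k) ∧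
      IsRatQuasipolynomial (fun k => ∑ m ∈ I k, g.eval fun i => ((m i : ℕ) : ℚ)) ℓ
        (D + Fintype.card ι - 1) := by
  classical
  obtain ⟨P, hP, hPs⟩ := exists_eval_eq_coeff_X_pow_mul_simplexSeries g hD (u := e / ℓ)
    (Nat.div_lt_of_lt_mul (by rwa [mul_comm]))
  refine ⟨fun k => if k % ℓ = e % ℓ ∧ e / ℓ ≤ k / ℓ then
    finsuppAntidiag univ (k / ℓ - e / ℓ) else ∅, fun k m => ?_, hℓ,
    fun j => if j = e % ℓ then
      P.comp (Polynomial.C (1 / (ℓ : ℚ)) * (Polynomial.X - Polynomial.C (j : ℚ))) else 0,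
    fun j _ => ?_, fun j hj k hk => ?_⟩
  · have hk := Nat.div_add_mod k ℓ
    have he := Nat.div_add_mod e ℓ
    dsimp only
    split_ifs with h
    · rw [mem_finsuppAntidiag]
      simp only [subset_univ, and_true]
      obtain ⟨c, hc⟩ := Nat.exists_eq_add_of_le h.2
      rw [hc, Nat.add_sub_cancel_left]
      rw [hc, h.1] at hk
      constructor
      · intro hm
        rw [hm]; linarith
      · intro hm
        refine Nat.eq_of_mul_eq_mul_left hℓ ?_
        linarith
    · simp only [notMem_empty, false_iff]
      rintro rfl
      exact h ⟨Nat.add_mul_mod_self_left _ _ _, Nat.div_le_div_right (Nat.le_add_right _ _)⟩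
  · dsimp only
    split_ifs
    · refine Polynomial.natDegree_comp_le.trans ?_
      have : (Polynomial.C (1 / (ℓ : ℚ)) *
          (Polynomial.X - Polynomial.C (j : ℚ))).natDegree ≤ 1 := by compute_degree
      nlinarith
    · simp
  · have hkj : k % ℓ = j := by rw [hk, Nat.mod_eq_of_lt hj]
    dsimp only
    rw [hkj]
    by_cases hje : j = e % ℓ
    · have hks : 1 / (ℓ : ℚ) * (k - j) = ((k / ℓ : ℕ) : ℚ) := by
        have hℓ' : (ℓ : ℚ) ≠ 0 := by positivity
        have : (ℓ : ℚ) * ((k / ℓ : ℕ) : ℚ) + j = k := by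
          exact_mod_cast hkj ▸ Nat.div_add_mod k ℓ
        rw [← this]
        field_simp
        ring
      rw [if_pos hje, Polynomial.eval_comp]
      simp only [Polynomial.eval_mul, Polynomial.eval_C, Polynomial.eval_sub, Polynomial.eval_X]
      rw [hks, ← hPs, mul_comm, PowerSeries.coeff_mul_X_pow']
      simp only [hje, true_and]
      split_ifs
      · rw [simplexSeries, PowerSeries.coeff_mk]
      · simp
    · simp [hje]

section ConeDecomposition

/-! ### Coordinates with respect to a simplicial cone -/

variable {n : ℕ}

/-- The inclusion `intVec : ℤⁿ → ℝⁿ` as an additive homomorphism. -/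
def intVecHom (n : ℕ) : (Fin n → ℤ) →+ (Fin n → ℝ) where
  toFun := intVec
  map_zero' := by ext; simp [intVec]
  map_add' x y := by ext; simp [intVec]

theorem intVecHom_apply (x : Fin n → ℤ) : intVecHom n x = intVec x := rfl

theorem intVec_injective : Function.Injective (intVec (n := n)) := fun x y h => by
  ext i
  simpa [intVec] using congrFun h i

variable {M : AddSubmonoid (Fin n → ℤ)}

theorem intVec_mem_subcone {σ : Finset M} {v : M} (hv : v ∈ σ) :
    intVec (v : Fin n → ℤ) ∈ subcone σ :=
  Submodule.subset_span ⟨v, ⟨v, hv, rfl⟩, rfl⟩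

theorem subcone_le_iff {σ : Finset M} {C : PointedCone ℝ (Fin n → ℝ)} :
    subcone σ ≤ C ↔ ∀ v ∈ σ, intVec (v : Fin n → ℤ) ∈ C := by
  refine ⟨fun h v hv => h (intVec_mem_subcone hv), fun h => ?_⟩
  refine Submodule.span_le.2 ?_
  rintro _ ⟨_, ⟨v, hv, rfl⟩, rfl⟩
  exact h v hv

theorem PointedCone.sum_smul_mem {E ι : Type*} [AddCommGroup E] [Module ℝ E]
    {C : PointedCone ℝ E} {s : Finset ι} {a : ι → ℝ} {v : ι → E} (ha : ∀ i ∈ s, 0 ≤ a i)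
    (hv : ∀ i ∈ s, v i ∈ C) : ∑ i ∈ s, a i • v i ∈ C :=
  sum_mem fun i hi => C.smul_mem (ha i hi) (hv i hi)

/-- A `ℤ`-basis of `gp(M)` spans the real span of `M`, so the dimension of the latter is at most the
rank of `M`. -/
theorem finrank_span_intVec_le :
    Module.finrank ℝ (Submodule.span ℝ (intVec '' (M : Set (Fin n → ℤ)))) ≤ monoidRank M := by
  let b := Module.finBasis ℤ (Submodule.span ℤ (M : Set (Fin n → ℤ)))
  have hle : Submodule.span ℝ (intVec '' (M : Set (Fin n → ℤ))) ≤
      Submodule.span ℝ (Set.range fun i => intVec (b i : Fin n → ℤ)) := by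
    refine Submodule.span_le.2 ?_
    rintro _ ⟨x, hx, rfl⟩
    have h := congrArg (fun y : Submodule.span ℤ (M : Set (Fin n → ℤ)) => intVecHom n y)
      (b.sum_repr ⟨x, Submodule.subset_span hx⟩)
    simp only [AddSubmonoidClass.coe_finsetSum, Submodule.coe_smul, map_sum, map_zsmul,
      intVecHom_apply] at h
    rw [SetLike.mem_coe, ← h]
    exact sum_mem fun i _ => zsmul_mem (Submodule.subset_span (Set.mem_range_self i)) _
  calc _ ≤ _ := Submodule.finrank_mono hle
    _ ≤ Fintype.card (Fin _) := finrank_range_le_card _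
    _ = _ := Fintype.card_fin _

/-- The functions `c i` are the coordinates of the elements of `M` with respect to the generators in
`σ`. They are recorded on `M` only, as homomorphisms to `ℝ`, which is all that is needed: the
perturbations `x + ε w` of a point of `M` are replaced by `N • x + w` with `N` large. -/
structure IsSimplicialCoords (σ : Finset M) (c : σ → M →+ ℝ) : Prop where
  apply_gen : ∀ i j : σ, c i j = if i = j then 1 else 0
  intVec_eq_sum : ∀ x : M, intVec (x : Fin n → ℤ) = ∑ i, c i x • intVec ((i : M) : Fin n → ℤ)
  mem_subcone_iff : ∀ x : M, intVec (x : Fin n → ℤ) ∈ subcone σ ↔ ∀ i, 0 ≤ c i x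

/-- The generators of a cone of the triangulation are as many as the rank of `M`, hence a basis of the
real span of `M`. -/
theorem IsConeTriangulation.exists_isSimplicialCoords {T : Finset (Finset M)}
    (hT : IsConeTriangulation M T) {σ : Finset M} (hσ : σ ∈ T) :
    ∃ c : σ → M →+ ℝ, IsSimplicialCoords σ c := by
  classical
  set v : σ → Fin n → ℝ := fun i => intVec ((i : M) : Fin n → ℤ)
  have hli : LinearIndependent ℝ v := hT.linearIndependent σ hσ
  have hspan : Submodule.span ℝ (Set.range v) =
      Submodule.span ℝ (intVec '' (M : Set (Fin n → ℤ))) := by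
    refine Submodule.eq_of_le_of_finrank_le (Submodule.span_mono ?_) ?_
    · rintro _ ⟨i, rfl⟩
      exact ⟨_, (i : M).2, rfl⟩
    · rw [finrank_span_eq_card hli, Fintype.card_coe, hT.card_eq σ hσ]
      exact finrank_span_intVec_le
  obtain ⟨g, hg⟩ := (Fintype.linearCombination ℝ v).exists_leftInverse_of_injective
    (LinearMap.ker_eq_bot.2 hli.fintypeLinearCombination_injective)
  have hg' : ∀ a : σ → ℝ, g (∑ i, a i • v i) = a := fun a => by
    simpa [Fintype.linearCombination_apply] using LinearMap.congr_fun hg a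
  have hgv : ∀ j, g (v j) = Pi.single j 1 := fun j => by
    have := hg' (Pi.single j 1)
    simpa [Pi.single_apply] using this
  have hsum : ∀ x : M, intVec (x : Fin n → ℤ) = ∑ i, g (intVec (x : Fin n → ℤ)) i • v i := by
    intro x
    have hx : intVec (x : Fin n → ℤ) ∈ Submodule.span ℝ (Set.range v) :=
      hspan ▸ Submodule.subset_span ⟨x, x.2, rfl⟩
    obtain ⟨a, ha⟩ := (Submodule.mem_span_range_iff_exists_fun ℝ).1 hx
    rw [← ha, hg']
  refine ⟨fun i => ((LinearMap.proj i ∘ₗ g).toAddMonoidHom.comp (intVecHom n)).comp M.subtype,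
    fun i j => ?_, hsum, fun x => ⟨fun hx i => ?_, fun hx => ?_⟩⟩
  · have := congrFun (hgv j) i
    simpa [intVecHom_apply, Pi.single_apply] using this
  · change 0 ≤ g (intVec (x : Fin n → ℤ)) i
    refine Submodule.span_induction (p := fun y _ => 0 ≤ g y i) ?_ (by simp) ?_ ?_ hx
    · rintro _ ⟨_, ⟨j, hj, rfl⟩, rfl⟩
      have := congrFun (hgv ⟨j, hj⟩) i
      simp only [v] at this
      rw [this, Pi.single_apply]
      split_ifs <;> simp
    · intro y z _ _ hy hz
      simpa using add_nonneg hy hz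
    · intro a y _ hy
      have : g (a • y) = (a : ℝ) • g y := map_smul g (a : ℝ) y
      rw [this]
      exact mul_nonneg a.2 hy
  · rw [hsum x]
    exact PointedCone.sum_smul_mem (fun i _ => hx i) fun i _ => intVec_mem_subcone i.2

theorem eventually_pos_nat_mul_add {a : ℝ} (ha : 0 < a) (b : ℝ) :
    ∀ᶠ N : ℕ in Filter.atTop, 0 < N * a + b := by
  obtain ⟨N₀, hN₀⟩ := exists_nat_gt (-b / a)
  filter_upwards [Filter.eventually_ge_atTop N₀] with N hN
  have : -b / a < N := hN₀.trans_le (by exact_mod_cast hN)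
  rw [div_lt_iff₀ ha] at this
  linarith

theorem eventually_neg_nat_mul_add {a : ℝ} (ha : a < 0) (b : ℝ) :
    ∀ᶠ N : ℕ in Filter.atTop, N * a + b < 0 := by
  filter_upwards [eventually_pos_nat_mul_add (neg_pos.2 ha) (-b)] with N hN
  linarith

/-- Finitely many homomorphisms, none of which vanishes identically, have a common point at which none
of them vanishes. It is found by passing from `w` to `N • w + x` with `N` large. -/
theorem exists_forall_apply_ne_zero {A κ : Type*} [AddCommMonoid A] (φ : κ → A →+ ℝ)
    (s : Finset κ) (h : ∀ k ∈ s, ∃ x, φ k x ≠ 0) : ∃ w, ∀ k ∈ s, φ k w ≠ 0 := by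
  classical
  induction s using Finset.induction_on with
  | empty => exact ⟨0, by simp⟩
  | insert k s _ ih =>
    obtain ⟨w, hw⟩ := ih fun j hj => h j (mem_insert_of_mem hj)
    obtain ⟨x, hx⟩ := h k (mem_insert_self _ _)
    by_cases hk : φ k w = 0
    · have hev : ∀ j ∈ s, ∀ᶠ N : ℕ in Filter.atTop, φ j (N • w + x) ≠ 0 := by
        intro j hj
        simp only [map_add, map_nsmul, nsmul_eq_mul]
        rcases (hw j hj).lt_or_gt with h0 | h0
        · exact (eventually_neg_nat_mul_add h0 _).mono fun _ => ne_of_lt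
        · exact (eventually_pos_nat_mul_add h0 _).mono fun _ => ne_of_gt
      obtain ⟨N, hN⟩ := ((Filter.eventually_all_finset s).2 hev).exists
      refine ⟨N • w + x, fun j hj => ?_⟩
      rcases mem_insert.1 hj with rfl | hj
      · simpa [hk] using hx
      · exact hN j hj
    · refine ⟨w, fun j hj => ?_⟩
      rcases mem_insert.1 hj with rfl | hj
      · exact hk
      · exact hw j hj

/-! ### Half-open decomposition -/

/-- For coordinates `c` with respect to a simplicial cone, `x` lies in the cone with those facets removed
that separate the cone from `w`. If all coordinates of `w` are nonzero, this says that `N • x + w` is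
an interior point of the cone for all large `N`. -/
def IsHalfOpenMem {ι : Type*} (c : ι → M →+ ℝ) (w x : M) : Prop :=
  ∀ i, 0 ≤ c i x ∧ (c i w < 0 → 0 < c i x)

namespace IsSimplicialCoords

variable {σ τ : Finset M} {c : σ → M →+ ℝ} {d : τ → M →+ ℝ} {w x : M}

theorem eventually_pos_of_isHalfOpenMem (hw : ∀ i, c i w ≠ 0) (hx : IsHalfOpenMem c w x) :
    ∀ᶠ N : ℕ in Filter.atTop, ∀ i, 0 < c i (N • x + w) := by
  refine Filter.eventually_all.2 fun i => ?_
  simp only [map_add, map_nsmul, nsmul_eq_mul]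
  rcases (hx i).1.eq_or_lt with h0 | h0
  · have : 0 < c i w := (hw i).lt_or_gt.resolve_left fun h => ((hx i).2 h).ne h0
    simp [← h0, this]
  · exact eventually_pos_nat_mul_add h0 _

theorem eventually_notMem_of_not_isHalfOpenMem (hc : IsSimplicialCoords σ c)
    (hx : ¬ IsHalfOpenMem c w x) :
    ∀ᶠ N : ℕ in Filter.atTop, intVec ((N • x + w : M) : Fin n → ℤ) ∉ subcone σ := by
  obtain ⟨i, hi⟩ := not_forall.1 hx
  have hev : ∀ᶠ N : ℕ in Filter.atTop, c i (N • x + w) < 0 := by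
    simp only [map_add, map_nsmul, nsmul_eq_mul]
    rcases lt_or_ge (c i x) 0 with h0 | h0
    · exact eventually_neg_nat_mul_add h0 _
    · simp only [not_and, Classical.not_imp, not_lt] at hi
      obtain ⟨h1, h2⟩ := hi h0
      simp [le_antisymm h2 h0, h1]
  filter_upwards [hev] with N hN hmem
  exact absurd ((hc.mem_subcone_iff _).1 hmem i) (not_le.2 hN)

/-- A face that contains an interior point is the whole cone. -/
theorem subcone_le_of_isFaceOf (hc : IsSimplicialCoords σ c) (hx : ∀ i, 0 < c i x)
    {F : PointedCone ℝ (Fin n → ℝ)} (hF : F.IsFaceOf (subcone σ))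
    (hxF : intVec (x : Fin n → ℤ) ∈ F) : subcone σ ≤ F := by
  classical
  refine subcone_le_iff.2 fun v hv => ?_
  rw [hc.intVec_eq_sum, ← add_sum_erase _ _ (mem_univ ⟨v, hv⟩)] at hxF
  exact hF.mem_of_smul_add_mem (intVec_mem_subcone hv)
    (PointedCone.sum_smul_mem (fun i _ => (hx i).le) fun i _ => intVec_mem_subcone i.2)
    (hx ⟨v, hv⟩) hxF

theorem ext_coords (hc : IsSimplicialCoords σ c) {x y : M} (h : ∀ i, c i x = c i y) : x = y := by
  refine Subtype.ext (intVec_injective ?_)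
  rw [hc.intVec_eq_sum, hc.intVec_eq_sum]
  simp [h]

/-- The condition `M = cone(M) ∩ L` enters through this lemma: differences with nonnegative coordinates
stay in `M`. -/
theorem exists_add_eq (hc : IsSimplicialCoords σ c) {L : AddSubgroup (Fin n → ℤ)}
    (hML : ∀ x : Fin n → ℤ, x ∈ M ↔ intVec x ∈ realCone (M : Set (Fin n → ℤ)) ∧ x ∈ L)
    {x y : M} (h : ∀ i, c i y ≤ c i x) : ∃ z : M, z + y = x := by
  have hz : (x - y : Fin n → ℤ) ∈ M := by
    refine (hML _).2 ⟨?_, sub_mem ((hML _).1 x.2).2 ((hML _).1 y.2).2⟩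
    have : intVec (x - y : Fin n → ℤ) = ∑ i, (c i x - c i y) • intVec ((i : M) : Fin n → ℤ) := by
      rw [← intVecHom_apply, map_sub, intVecHom_apply, intVecHom_apply, hc.intVec_eq_sum x,
        hc.intVec_eq_sum y, ← sum_sub_distrib]
      simp only [sub_smul]
    rw [this]
    exact PointedCone.sum_smul_mem (fun i _ => sub_nonneg.2 (h i)) fun i _ =>
      Submodule.subset_span ⟨_, (i : M).2, rfl⟩
  exact ⟨⟨_, hz⟩, Subtype.ext (sub_add_cancel _ _)⟩

/-- A nonzero element of `M` has a positive coordinate: otherwise its negative would lie in `M` as well,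
contrary to the positivity of the grading. -/
theorem exists_pos (hc : IsSimplicialCoords σ c) {L : AddSubgroup (Fin n → ℤ)}
    (hML : ∀ x : Fin n → ℤ, x ∈ M ↔ intVec x ∈ realCone (M : Set (Fin n → ℤ)) ∧ x ∈ L)
    {deg : M →+ ℤ} (hdeg : IsPositiveGrading deg) (hw : w ≠ 0) : ∃ i, 0 < c i w := by
  by_contra! h
  obtain ⟨z, hz⟩ := hc.exists_add_eq hML (x := 0) (y := w) (by simpa using h)
  have h1 := hdeg w hw
  have h2 : 0 ≤ deg z := by
    rcases eq_or_ne z 0 with rfl | h0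
    · simp
    · exact (hdeg z h0).le
  have h3 : deg z + deg w = 0 := by rw [← map_add, hz, map_zero]
  omega

end IsSimplicialCoords

/-- The half-open cones cover `M`. -/
theorem IsConeTriangulation.exists_isHalfOpenMem {T : Finset (Finset M)}
    (hT : IsConeTriangulation M T) {c : ∀ σ : T, σ.1 → M →+ ℝ}
    (hc : ∀ σ : T, IsSimplicialCoords (σ : Finset M) (c σ)) (w x : M) :
    ∃ σ : T, IsHalfOpenMem (c σ) w x := by
  by_contra! h
  obtain ⟨N, hN⟩ := (Filter.eventually_all.2 fun σ : T =>
    (hc σ).eventually_notMem_of_not_isHalfOpenMem (h σ)).exists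
  have hmem : intVec ((N • x + w : M) : Fin n → ℤ) ∈
      (realCone (M : Set (Fin n → ℤ)) : Set (Fin n → ℝ)) :=
    Submodule.subset_span ⟨_, (N • x + w).2, rfl⟩
  rw [hT.cover] at hmem
  simp only [Set.mem_iUnion] at hmem
  obtain ⟨σ, hσ, hmem⟩ := hmem
  exact hN ⟨σ, hσ⟩ hmem

/-- The half-open cones are disjoint on `M`, provided that `w` lies on no facet hyperplane. -/
theorem IsConeTriangulation.eq_of_isHalfOpenMem {T : Finset (Finset M)}
    (hT : IsConeTriangulation M T) {c : ∀ σ : T, σ.1 → M →+ ℝ}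
    (hc : ∀ σ : T, IsSimplicialCoords (σ : Finset M) (c σ)) {w x : M}
    (hw : ∀ σ i, c σ i w ≠ 0) {σ τ : T} (hσ : IsHalfOpenMem (c σ) w x)
    (hτ : IsHalfOpenMem (c τ) w x) : σ = τ := by
  obtain ⟨N, hNσ, hNτ⟩ := ((IsSimplicialCoords.eventually_pos_of_isHalfOpenMem (hw σ) hσ).and
    (IsSimplicialCoords.eventually_pos_of_isHalfOpenMem (hw τ) hτ)).exists
  have hzσ := ((hc σ).mem_subcone_iff _).2 fun i => (hNσ i).le
  have hzτ := ((hc τ).mem_subcone_iff _).2 fun i => (hNτ i).le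
  have h1 := (hc σ).subcone_le_of_isFaceOf hNσ (hT.face σ σ.2 τ τ.2) ⟨hzσ, hzτ⟩
  have h2 := (hc τ).subcone_le_of_isFaceOf hNτ (hT.face τ τ.2 σ σ.2) ⟨hzτ, hzσ⟩
  exact Subtype.ext (hT.injOn σ.2 τ.2 (le_antisymm (h1.trans inf_le_right) (h2.trans inf_le_right)))

/-! ### Lattice points of a half-open cone -/

/-- The elements of `M` in the half-open parallelotope spanned by the multiples `b i • i` of the
generators `i ∈ σ`. The `i`-th coordinate ranges over `(0, b i]` if the facet opposite to `i` is
removed from the half-open cone, and over `[0, b i)` otherwise. -/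
def halfOpenBox {σ : Finset M} (c : σ → M →+ ℝ) (w : M) (b : σ → ℕ) : Set M :=
  {y | ∀ i, c i y ∈ if c i w < 0 then Set.Ioc 0 (b i : ℝ) else Set.Ico 0 (b i : ℝ)}

/-- The point `y + ∑ i, m i • (b i • i)`. -/
def latticeTranslate {σ : Finset M} (b : σ → ℕ) (y : M) (m : σ →₀ ℕ) : M :=
  y + ∑ i, (m i * b i) • (i : M)

namespace IsSimplicialCoords

variable {σ : Finset M} {c : σ → M →+ ℝ} {w x y : M} {b : σ → ℕ}

theorem apply_sum_smul (hc : IsSimplicialCoords σ c) (a : σ → ℕ) (i : σ) :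
    c i (∑ j, a j • (j : M)) = a i := by
  simp [map_sum, hc.apply_gen]

theorem apply_latticeTranslate (hc : IsSimplicialCoords σ c) (y : M) (m : σ →₀ ℕ) (i : σ) :
    c i (latticeTranslate b y m) = c i y + m i * b i := by
  rw [latticeTranslate, map_add, hc.apply_sum_smul]
  push_cast; rfl

theorem mem_Icc_of_mem_halfOpenBox (hy : y ∈ halfOpenBox c w b) (i : σ) :
    c i y ∈ Set.Icc 0 (b i : ℝ) := by
  have := hy i
  split_ifs at this
  · exact Set.Ioc_subset_Icc_self this
  · exact Set.Ico_subset_Icc_self this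

/-- The box consists of lattice points in a bounded region. -/
theorem finite_halfOpenBox (hc : IsSimplicialCoords σ c) : (halfOpenBox c w b).Finite := by
  set B : Fin n → ℤ := fun k => ∑ i, (b i : ℤ) * |((i : M) : Fin n → ℤ) k|
  refine ((Set.finite_Icc (-B) B).preimage Subtype.val_injective.injOn).subset fun y hy => ?_
  have hB : ∀ k, |((y : Fin n → ℤ) k)| ≤ B k := by
    intro k
    have h := congrFun (hc.intVec_eq_sum y) k
    have : |(((y : Fin n → ℤ) k : ℤ) : ℝ)| ≤ ((B k : ℤ) : ℝ) := by
      change intVec (y : Fin n → ℤ) k = _ at h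
      rw [show (((y : Fin n → ℤ) k : ℤ) : ℝ) = intVec (y : Fin n → ℤ) k from rfl, h, Finset.sum_apply]
      refine (abs_sum_le_sum_abs _ _).trans ?_
      push_cast [B]
      refine sum_le_sum fun i _ => ?_
      obtain ⟨h0, h1⟩ := mem_Icc_of_mem_halfOpenBox hy i
      rw [Pi.smul_apply, smul_eq_mul, abs_mul, abs_of_nonneg h0]
      exact mul_le_mul_of_nonneg_right h1 (abs_nonneg _)
    exact_mod_cast this
  exact ⟨fun k => (abs_le.1 (hB k)).1, fun k => (abs_le.1 (hB k)).2⟩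

theorem isHalfOpenMem_latticeTranslate (hc : IsSimplicialCoords σ c)
    (hy : y ∈ halfOpenBox c w b) (m : σ →₀ ℕ) :
    IsHalfOpenMem c w (latticeTranslate b y m) := by
  intro i
  rw [hc.apply_latticeTranslate]
  have h0 : (0 : ℝ) ≤ m i * b i := by positivity
  refine ⟨add_nonneg (mem_Icc_of_mem_halfOpenBox hy i).1 h0, fun hi => ?_⟩
  have := hy i
  rw [if_pos hi] at this
  exact add_pos_of_pos_of_nonneg this.1 h0

theorem latticeTranslate_injOn (hc : IsSimplicialCoords σ c) (hb : ∀ i, 0 < b i) {y y' : M}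
    {m m' : σ →₀ ℕ} (hy : y ∈ halfOpenBox c w b) (hy' : y' ∈ halfOpenBox c w b)
    (h : latticeTranslate b y m = latticeTranslate b y' m') : y = y' ∧ m = m' := by
  have hcoord : ∀ i, c i y + m i * b i = c i y' + m' i * b i := fun i => by
    rw [← hc.apply_latticeTranslate, ← hc.apply_latticeTranslate, h]
  have hm : m = m' := by
    ext i
    have hbi : (0 : ℝ) < b i := by exact_mod_cast hb i
    have hlt : |c i y - c i y'| < b i := by
      have h1 := hy i
      have h2 := hy' i
      rw [abs_lt]
      split_ifs at h1 h2 <;> constructor <;> linarith [h1.1, h1.2, h2.1, h2.2]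
    have heq : c i y - c i y' = ((m' i : ℝ) - m i) * b i := by linarith [hcoord i]
    rw [heq, abs_mul, abs_of_pos hbi] at hlt
    have : |((m' i : ℤ) - m i : ℤ)| < 1 := by
      have : |(m' i : ℝ) - m i| < 1 := by
        by_contra! hge
        nlinarith
      exact_mod_cast this
    have := Int.abs_lt_one_iff.1 this
    omega
  refine ⟨hc.ext_coords fun i => ?_, hm⟩
  have := hcoord i
  rw [hm] at this
  linarith

/-- Every point of the half-open cone is reduced into the box by division with remainder in each
coordinate. -/
theorem exists_latticeTranslate_eq (hc : IsSimplicialCoords σ c) {L : AddSubgroup (Fin n → ℤ)}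
    (hML : ∀ x : Fin n → ℤ, x ∈ M ↔ intVec x ∈ realCone (M : Set (Fin n → ℤ)) ∧ x ∈ L)
    (hb : ∀ i, 0 < b i) (hx : IsHalfOpenMem c w x) :
    ∃ y ∈ halfOpenBox c w b, ∃ m, latticeTranslate b y m = x := by
  have key : ∀ i, ∃ m : ℕ,
      c i x - m * b i ∈ if c i w < 0 then Set.Ioc 0 (b i : ℝ) else Set.Ico 0 (b i : ℝ) := by
    intro i
    have hbi : (0 : ℝ) < b i := by exact_mod_cast hb i
    have hnat : ∀ k : ℤ, 0 < ((k : ℝ) + 1) * b i → ∃ m : ℕ, (m : ℤ) = k := fun k hk => by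
      have : (0 : ℝ) < k + 1 := pos_of_mul_pos_left hk hbi.le
      have : 0 < k + 1 := by exact_mod_cast this
      exact ⟨k.toNat, Int.toNat_of_nonneg (by omega)⟩
    split_ifs with hi
    · obtain ⟨k, hk, -⟩ := existsUnique_sub_zsmul_mem_Ioc hbi (c i x) 0
      rw [zero_add, zsmul_eq_mul] at hk
      obtain ⟨m, rfl⟩ := hnat k (by have := (hx i).2 hi; linarith [hk.2])
      exact ⟨m, by simpa using hk⟩
    · obtain ⟨k, hk, -⟩ := existsUnique_sub_zsmul_mem_Ico hbi (c i x) 0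
      rw [zero_add, zsmul_eq_mul] at hk
      obtain ⟨m, rfl⟩ := hnat k (by have := (hx i).1; linarith [hk.2])
      exact ⟨m, by simpa using hk⟩
  choose m hm using key
  have hle : ∀ i, c i (∑ j, (m j * b j) • (j : M)) ≤ c i x := fun i => by
    rw [hc.apply_sum_smul]
    have := hm i
    push_cast
    split_ifs at this <;> linarith [this.1]
  obtain ⟨y, hy⟩ := hc.exists_add_eq hML hle
  refine ⟨y, fun i => ?_, Finsupp.equivFunOnFinite.symm m, hy⟩
  have : c i y = c i x - m i * b i := by
    rw [← hy, map_add, hc.apply_sum_smul]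
    push_cast; ring
  rw [this]
  exact hm i

/-- At least one coordinate ranges over `[0, b i)`, since `w` has a positive coordinate. So the corner
`∑ i, b i • i` minus a point of the box is a nonzero element of `M`. This strict inequality makes the
quasipolynomial correct in small degrees too. -/
theorem degree_lt_of_mem_halfOpenBox (hc : IsSimplicialCoords σ c) {L : AddSubgroup (Fin n → ℤ)}
    (hML : ∀ x : Fin n → ℤ, x ∈ M ↔ intVec x ∈ realCone (M : Set (Fin n → ℤ)) ∧ x ∈ L)
    {deg : M →+ ℤ} (hdeg : IsPositiveGrading deg) (hw : w ≠ 0) (hy : y ∈ halfOpenBox c w b) :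
    deg y < ∑ i, b i * deg i := by
  obtain ⟨i, hi⟩ := hc.exists_pos hML hdeg hw
  obtain ⟨z, hz⟩ := hc.exists_add_eq hML (x := ∑ j, b j • (j : M)) (y := y) fun j => by
    rw [hc.apply_sum_smul]
    exact (mem_Icc_of_mem_halfOpenBox hy j).2
  have hz0 : z ≠ 0 := by
    rintro rfl
    have := hy i
    rw [if_neg hi.le.not_gt, ← zero_add y, hz, hc.apply_sum_smul] at this
    exact lt_irrefl _ this.2
  have := congrArg deg hz
  simp only [map_add, map_sum, map_nsmul, nsmul_eq_mul] at this
  linarith [hdeg z hz0]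

end IsSimplicialCoords

/-! ### The contribution of a half-open cone -/

theorem IsPositiveGrading.nonneg {deg : M →+ ℤ}
    (hdeg : IsPositiveGrading deg) (x : M) : 0 ≤ deg x := by
  rcases eq_or_ne x 0 with rfl | h
  · simp
  · exact (hdeg x h).le

/-- The polynomial `m ↦ f (latticeTranslate b y m)`. -/
noncomputable def pullbackPolynomial {σ : Finset M} (b : σ → ℕ) (y : M)
    (f : MvPolynomial (Fin n) ℚ) : MvPolynomial σ ℚ :=
  MvPolynomial.aeval (fun k => MvPolynomial.C (((y : Fin n → ℤ) k : ℤ) : ℚ) +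
    ∑ i, MvPolynomial.C ((b i : ℚ) * ((((i : M) : Fin n → ℤ) k : ℤ) : ℚ)) * MvPolynomial.X i) f

theorem totalDegree_pullbackPolynomial_le {σ : Finset M} (b : σ → ℕ) (y : M)
    (f : MvPolynomial (Fin n) ℚ) :
    (pullbackPolynomial b y f).totalDegree ≤ f.totalDegree := by
  refine totalDegree_aeval_le f _ fun k => ?_
  refine (MvPolynomial.totalDegree_add _ _).trans (max_le ?_ ?_)
  · rw [MvPolynomial.totalDegree_C]
    exact zero_le_one
  refine MvPolynomial.totalDegree_finsetSum_le fun i _ => ?_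
  refine (MvPolynomial.totalDegree_mul _ _).trans ?_
  rw [MvPolynomial.totalDegree_C, MvPolynomial.totalDegree_X]

theorem eval_pullbackPolynomial {σ : Finset M} (b : σ → ℕ) (y : M)
    (f : MvPolynomial (Fin n) ℚ) (m : σ →₀ ℕ) :
    (pullbackPolynomial b y f).eval (fun i => ((m i : ℕ) : ℚ)) =
      f.eval fun k => (((latticeTranslate b y m : M) : Fin n → ℤ) k : ℚ) := by
  rw [pullbackPolynomial, ← MvPolynomial.coe_aeval_eq_eval, RingHom.coe_coe,
    ← MvPolynomial.coe_aeval_eq_eval, RingHom.coe_coe, ← AlgHom.comp_apply,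
    MvPolynomial.comp_aeval]
  congr 2
  ext k
  simp only [map_add, map_sum, map_mul, MvPolynomial.aeval_X, MvPolynomial.algHom_C,
    latticeTranslate, AddSubmonoid.coe_add, AddSubmonoidClass.coe_finsetSum, Pi.add_apply,
    Finset.sum_apply, AddSubmonoidClass.coe_nsmul, nsmul_eq_mul]
  push_cast
  congr 1
  refine sum_congr rfl fun i _ => ?_
  simp; ring

theorem degree_latticeTranslate {σ : Finset M} {deg : M →+ ℤ} {b : σ → ℕ} {ℓ : ℕ}
    (hb : ∀ i : σ, b i * deg i = ℓ) (y : M) (m : σ →₀ ℕ) :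
    deg (latticeTranslate b y m) = deg y + ℓ * ∑ i, (m i : ℤ) := by
  simp only [latticeTranslate, map_add, map_sum, map_nsmul, nsmul_eq_mul, mul_sum]
  congr 1
  refine sum_congr rfl fun i _ => ?_
  push_cast
  rw [mul_assoc, hb, mul_comm]

/-- The contribution of one half-open cone. All generators are scaled to the common degree `ℓ`, so that
the degree of a translate of `y` is `deg y + ℓ * ∑ i, m i`. -/
theorem IsSimplicialCoords.exists_finset_isRatQuasipolynomial_sum {σ : Finset M}
    {c : σ → M →+ ℝ} (hc : IsSimplicialCoords σ c) {L : AddSubgroup (Fin n → ℤ)}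
    (hML : ∀ x : Fin n → ℤ, x ∈ M ↔ intVec x ∈ realCone (M : Set (Fin n → ℤ)) ∧ x ∈ L)
    {deg : M →+ ℤ} (hdeg : IsPositiveGrading deg) {w : M} (hw : w ≠ 0) {ℓ : ℕ} (hℓ : 0 < ℓ)
    (hσ : ∀ i ∈ σ, (deg i).natAbs ∣ ℓ) (f : MvPolynomial (Fin n) ℚ) :
    ∃ S : ℕ → Finset M, (∀ k x, x ∈ S k ↔ deg x = k ∧ IsHalfOpenMem c w x) ∧
      IsRatQuasipolynomial
        (fun k => ∑ x ∈ S k, f.eval fun i => (((x : Fin n → ℤ) i : ℤ) : ℚ)) ℓ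
        (f.totalDegree + σ.card - 1) := by
  classical
  choose b hb using fun i : σ => hσ i i.2
  have hb0 : ∀ i, 0 < b i := fun i => Nat.pos_of_ne_zero fun h0 => by
    have := hb i
    rw [h0, mul_zero] at this
    omega
  have hbdeg : ∀ i : σ, b i * deg i = ℓ := fun i => by
    conv_rhs => rw [hb i]
    push_cast
    rw [abs_of_nonneg (hdeg.nonneg _), mul_comm]
  set B := (hc.finite_halfOpenBox (w := w) (b := b)).toFinset
  have hlt : ∀ y ∈ B, (deg y).toNat < Fintype.card σ * ℓ := by
    intro y hy
    have h := hc.degree_lt_of_mem_halfOpenBox hML hdeg hw ((Set.Finite.mem_toFinset _).1 hy)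
    simp only [hbdeg, sum_const, nsmul_eq_mul, card_univ] at h
    have := hdeg.nonneg y
    zify
    rwa [Int.toNat_of_nonneg this]
  choose! I hI hIq using fun y hy => _root_.exists_finset_isRatQuasipolynomial_sum
    (pullbackPolynomial b y f) (totalDegree_pullbackPolynomial_le b y f) hℓ (hlt y hy)
  have hI' : ∀ y ∈ B, ∀ k m, m ∈ I y k ↔ deg (latticeTranslate b y m) = k := by
    intro y hy k m
    have := hdeg.nonneg y
    rw [hI y hy, degree_latticeTranslate hbdeg]
    zify
    rw [Int.toNat_of_nonneg this]
  refine ⟨fun k => (B.sigma fun y => I y k).image fun p => latticeTranslate b p.1 p.2,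
    fun k x => ?_, ?_⟩
  · simp only [mem_image, mem_sigma]
    constructor
    · rintro ⟨⟨y, m⟩, ⟨hy, hm⟩, rfl⟩
      exact ⟨(hI' y hy k m).1 hm,
        hc.isHalfOpenMem_latticeTranslate ((Set.Finite.mem_toFinset _).1 hy) m⟩
    · rintro ⟨hdx, hx⟩
      obtain ⟨y, hy, m, rfl⟩ := hc.exists_latticeTranslate_eq hML hb0 hx
      have hy' : y ∈ B := (Set.Finite.mem_toFinset _).2 hy
      exact ⟨⟨y, m⟩, ⟨hy', (hI' y hy' k m).2 hdx⟩, rfl⟩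
  · have hsum := IsRatQuasipolynomial.sum hℓ hIq
    rw [Fintype.card_coe] at hsum
    convert hsum using 2 with k
    rw [sum_image, sum_sigma]
    · exact sum_congr rfl fun y _ => sum_congr rfl fun m _ => (eval_pullbackPolynomial b y f m).symm
    · rintro ⟨y, m⟩ hp ⟨y', m'⟩ hp' heq
      obtain ⟨rfl, rfl⟩ := hc.latticeTranslate_injOn hb0
        ((Set.Finite.mem_toFinset _).1 (mem_sigma.1 hp).1)
        ((Set.Finite.mem_toFinset _).1 (mem_sigma.1 hp').1) heq
      rfl

end ConeDecomposition

/-! ### The generalized Ehrhart series -/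

theorem proposition2p1 {n : ℕ} (L : AddSubgroup (Fin n → ℤ)) (M : AddSubmonoid (Fin n → ℤ))
    (hM_fg : M.FG) (hM_ne : M ≠ ⊥)
    (hML : ∀ x : Fin n → ℤ, x ∈ M ↔ intVec x ∈ realCone (M : Set (Fin n → ℤ)) ∧ x ∈ L)
    (deg : M →+ ℤ) (hdeg : IsPositiveGrading deg)
    (T : Finset (Finset M)) (hT : IsConeTriangulation M T)
    (f : MvPolynomial (Fin n) ℚ) :
    (∀ k : ℕ, {x : M | deg x = (k : ℤ)}.Finite) ∧
    ∃ (q : ℕ → ℚ) (π : ℕ),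
      ehrhartSeries deg f = PowerSeries.mk q ∧
      π ∣ degreeLcm deg T ∧
      IsRatQuasipolynomial q π (f.totalDegree + monoidRank M - 1) := by
  classical
  choose c hc using fun σ : T => hT.exists_isSimplicialCoords σ.2
  have hgen : ∀ (σ : T) (i : σ.1), c σ i i ≠ 0 := fun σ i => by simp [(hc σ).apply_gen]
  obtain ⟨w₀, hw₀⟩ := exists_forall_apply_ne_zero (fun p : Σ σ : T, σ.1 => c p.1 p.2) univ
    fun p _ => ⟨p.2, hgen p.1 p.2⟩
  have hw : ∀ σ i, c σ i w₀ ≠ 0 := fun σ i => hw₀ ⟨σ, i⟩ (mem_univ _)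
  obtain ⟨x₁, hx₁, hne⟩ := M.bot_or_exists_ne_zero.resolve_left hM_ne
  -- A cone of `T` has a generator, since otherwise it would be zero and could not contain `x₁`.
  have hw0 : w₀ ≠ 0 := by
    rintro rfl
    obtain ⟨σ, -⟩ := hT.exists_isHalfOpenMem hc 0 ⟨x₁, hx₁⟩
    have : (⟨x₁, hx₁⟩ : M) = 0 := (hc σ).ext_coords fun i => absurd (map_zero _) (hw σ i)
    exact hne (congrArg Subtype.val this)
  have hℓ : 0 < degreeLcm deg T := by
    refine Nat.pos_of_ne_zero fun h0 => ?_
    obtain ⟨σ, hσ, h0⟩ := Finset.lcm_eq_zero_iff.1 h0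
    obtain ⟨v, hv, h0⟩ := Finset.lcm_eq_zero_iff.1 h0
    have hv0 : v ≠ 0 := by
      rintro rfl
      exact hgen ⟨σ, hσ⟩ ⟨0, hv⟩ (map_zero _)
    have := hdeg v hv0
    omega
  have hdvd : ∀ σ : T, ∀ i ∈ σ.1, (deg i).natAbs ∣ degreeLcm deg T := fun σ i hi =>
    (Finset.dvd_lcm hi).trans (Finset.dvd_lcm (f := fun σ : Finset M => σ.lcm fun v =>
      (deg v).natAbs) σ.2)
  choose S hS hSq using fun σ : T =>
    (hc σ).exists_finset_isRatQuasipolynomial_sum hML hdeg hw0 hℓ (hdvd σ) f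
  have hset : ∀ k : ℕ, {x : M | deg x = (k : ℤ)} = ↑(univ.biUnion fun σ => S σ k) := fun k => by
    ext x
    simp only [Set.mem_ofPred_eq, coe_biUnion, Set.mem_iUnion, mem_coe, hS, mem_univ,
      exists_true_left, exists_and_left]
    exact ⟨fun h => ⟨h, hT.exists_isHalfOpenMem hc w₀ x⟩, And.left⟩
  refine ⟨fun k => hset k ▸ finite_toSet _,
    fun k => ∑ σ, ∑ x ∈ S σ k, f.eval fun i => (((x : Fin n → ℤ) i : ℤ) : ℚ), _, ?_, dvd_rfl,
    IsRatQuasipolynomial.sum hℓ fun σ _ => hT.card_eq σ σ.2 ▸ hSq σ⟩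
  refine congrArg PowerSeries.mk (funext fun k => ?_)
  rw [hset k, finsum_mem_coe_finset, sum_biUnion]
  intro σ _ τ _ hne
  refine disjoint_left.2 fun x hσ hτ => hne ?_
  exact hT.eq_of_isHalfOpenMem hc hw ((hS σ k x).1 hσ).2 ((hS τ k x).1 hτ).2
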